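/- Let $R$ be a finite chain ring (a finite commutative local ring whose ideals are totally ordered by inclusion) with residue field $\mathbb F_q$, let $h\in R[x]$ be monic of degree $m$ with irreducible image in $\mathbb F_q[x]$, and let $S=R[x]/(h)$, a free $R$-module of rank $m$. A matrix $A\in R^{a\times b}$ has a Smith normal form $A=PDQ$ with $P,Q$ invertible and $D=\mathrm{Diag}(d_1,\dots,d_r)$, $r=\min\{a,b\}$, $d_1\mid d_2\mid\cdots\mid d_r$; put $\mathrm{rk}(A)=|\{i: d_i\neq 0\}|$ and $\mathrm{frk}(A)=|\{i: d_i\in R^*\}|$. For an ordered $R$-basis $\alpha$ of $S$ and a vector $\mathbf v\in S^s$, let $\mathrm{rk}(\mathbf v)$ be the rank of the $m\times s$ matrix over $R$ whose columns are the coordinates of the entries of $\mathbf v$ in $\alpha$. For a length partition $n=n_1+\cdots+n_\ell$ and $\mathbf c=(\mathbf c^{(1)},\dots,\mathbf c^{(\ell)})\in S^n$ with $\mathbf c^{(i)}\in S^{n_i}$, let $\mathrm{wt}_{SR}(\mathbf c)=\sum_{i=1}^{\ell}\mathrm{rk}(\mathbf c^{(i)})$. For a nonempty code $\mathcal C\subseteq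 S^n$ (linear or not) let $\mathrm d_{SR}(\mathcal C)$ be the minimum of $\mathrm{wt}_{SR}(\mathbf c-\mathbf d)$ over distinct $\mathbf c,\mathbf d\in\mathcal C$ ($\infty$ if $|\mathcal C|=1$). The code $\mathcal C$ is MSRD if $k=\log_{|S|}|\mathcal C|$ is a positive integer and $\mathrm d_{SR}(\mathcal C)=n-k+1$; its information rate is $\frac1n\log_{|S|}|\mathcal C|$. For $N=N_1+\cdots+N_\ell$ and $A=\mathrm{Diag}(A_1,\dots,A_\ell)$ with $A_i\in R^{n_i\times N_i}$, consider the channel $\mathbf y=\mathbf cA+\mathbf e\in S^N$, where $\mathbf c\in\mathcal C$, $\mathbf e\in S^N$, the sum-rank weight on $S^N$ is taken for the partition $N=N_1+\cdots+N_\ell$, and $A$ is known to the receiver. **Theorem.** (1) Let $\rho=n-\mathrm{frk}(A)$ and let $t\ge 0$ be an integer. If $2t+\rho+1\le \mathrm d_{SR}(\mathcal C)$, then there exists a decoder $D_A:S^N\to\mathcal C$ such that $D_A(\mathbf cA+\mathbf e)=\mathbf c$ for all $\mathbf c\in\mathcal C$ and all $\mathbf e\in S^N$ with $\mathrm{wt}_{SR}(\mathbf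 e)\le t$. (2) In particular, let $\mathcal C$ be an MSRD code and let $t,\rho\ge 0$ be integers with $2t+\rho+1\le \mathrm d_{SR}(\mathcal C)$. Then $\mathcal C$ corrects $t$ link errors and $\rho$ packet erasures: for all $N_1,\dots,N_\ell$ and every $A=\mathrm{Diag}(A_1,\dots,A_\ell)$ as above with $\mathrm{frk}(A)\ge n-\rho$, a decoder $D_A$ as in (1) exists. If moreover $\mathrm d_{SR}(\mathcal C)=2t+\rho+1$, then the information rate of $\mathcal C$ equals $\dfrac{n-2t-\rho}{n}$. -/

import Mathlib

open scoped BigOperators Polynomial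

namespace SumRank

noncomputable section

/-- A chain ring: any two ideals are comparable. (Used together with `IsLocalRing` and `Finite`.) -/
def IsChainRing (R : Type*) [CommRing R] : Prop :=
  ∀ I J : Ideal R, I ≤ J ∨ J ≤ I

section Smith

variable {R : Type*} [CommRing R] {m n : ℕ}

/-- The rectangular diagonal matrix `Diag(d_1, ..., d_r)` of size `m × n`, `r = min m n`. -/
def rectDiag (d : Fin (min m n) → R) : Matrix (Fin m) (Fin n) R :=
  Matrix.of fun i j =>
    if h : (i : ℕ) = (j : ℕ) then
      d ⟨i, lt_min i.isLt (h ▸ j.isLt)⟩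
    else 0

/-- `d` is the diagonal of a Smith normal form of `A`: `A = P * Diag(d_1, ..., d_r) * Q` with `P`, `Q`
invertible and `d_1 ∣ d_2 ∣ ... ∣ d_r`. -/
def IsSmithDiag (A : Matrix (Fin m) (Fin n) R) (d : Fin (min m n) → R) : Prop :=
  (∃ (P : Matrix (Fin m) (Fin m) R) (Q : Matrix (Fin n) (Fin n) R),
    IsUnit P ∧ IsUnit Q ∧ A = P * rectDiag d * Q) ∧
  ∀ i j : Fin (min m n), i ≤ j → d i ∣ d j

/-- The diagonal of the Smith normal form of `A`. Over a finite chain ring it exists for every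
matrix and is unique up to multiplication of its entries by units. -/
def smithDiag (A : Matrix (Fin m) (Fin n) R) : Fin (min m n) → R :=
  Classical.epsilon (IsSmithDiag A)

/-- The rank: the number of nonzero diagonal entries of the Smith normal form. -/
def rk (A : Matrix (Fin m) (Fin n) R) : ℕ :=
  Nat.card {i : Fin (min m n) // smithDiag A i ≠ 0}

/-- The free rank: the number of diagonal entries of the Smith normal form that are units. -/
def frk (A : Matrix (Fin m) (Fin n) R) : ℕ :=
  Nat.card {i : Fin (min m n) // IsUnit (smithDiag A i)}

end Smith

section Metric

variable {R S : Type*} [CommRing R] [CommRing S] [Algebra R S] {m ℓ : ℕ}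

/-- The matrix representation `M_α(c)`: column `j` holds the coordinates of `c j` in the ordered
basis `α`. -/
def matrixRep (α : Module.Basis (Fin m) R S) {s : ℕ} (c : Fin s → S) :
    Matrix (Fin m) (Fin s) R :=
  Matrix.of fun i j => α.repr (c j) i

/-- The `i`-th block `c^(i)` of length `n i` of a vector `c` of length `n_1 + ... + n_ℓ`. -/
def block (n : Fin ℓ → ℕ) (c : Fin (∑ i, n i) → S) (i : Fin ℓ) : Fin (n i) → S :=
  fun j => c (finSigmaFinEquiv ⟨i, j⟩)

/-- The sum-rank weight for the length partition `n_1 + ... + n_ℓ`. -/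
def wtSR (α : Module.Basis (Fin m) R S) (n : Fin ℓ → ℕ) (c : Fin (∑ i, n i) → S) : ℕ :=
  ∑ i, rk (matrixRep α (block n c i))

/-- The sum-rank distance of two vectors. -/
def distSR (α : Module.Basis (Fin m) R S) (n : Fin ℓ → ℕ) (c d : Fin (∑ i, n i) → S) : ℕ :=
  wtSR α n (c - d)

/-- The minimum sum-rank distance of a code, `⊤` for a code with at most one codeword. -/
def minDistSR (α : Module.Basis (Fin m) R S) (n : Fin ℓ → ℕ)
    (C : Set (Fin (∑ i, n i) → S)) : ℕ∞ :=
  ⨅ (c ∈ C) (d ∈ C) (_ : c ≠ d), (distSR α n c d : ℕ∞)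

/-- `log_{|S|} |C|`. -/
def logSize {s : ℕ} (C : Set (Fin s → S)) : ℝ :=
  Real.logb (Nat.card S) (Nat.card C)

/-- The information rate of a code of length `s`. -/
def rate {s : ℕ} (C : Set (Fin s → S)) : ℝ :=
  logSize C / s

/-- Maximum sum-rank distance codes: `k = log_{|S|} |C|` is a positive integer and the minimum
distance is `n - k + 1`. -/
def IsMSRD (α : Module.Basis (Fin m) R S) (n : Fin ℓ → ℕ)
    (C : Set (Fin (∑ i, n i) → S)) : Prop :=
  ∃ k : ℕ, 0 < k ∧ logSize C = k ∧ minDistSR α n C + k = ((∑ i, n i : ℕ) : ℕ∞) + 1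

/-- The block-diagonal matrix `Diag(A_1, ..., A_ℓ)`. -/
def blockDiag {n N : Fin ℓ → ℕ} (A : (i : Fin ℓ) → Matrix (Fin (n i)) (Fin (N i)) R) :
    Matrix (Fin (∑ i, n i)) (Fin (∑ i, N i)) R :=
  Matrix.reindex finSigmaFinEquiv finSigmaFinEquiv (Matrix.blockDiagonal' A)

/-- The channel output `y = c * Diag(A_1, ..., A_ℓ) + e`. -/
def channelOutput {n N : Fin ℓ → ℕ} (A : (i : Fin ℓ) → Matrix (Fin (n i)) (Fin (N i)) R)
    (c : Fin (∑ i, n i) → S) (e : Fin (∑ i, N i) → S) : Fin (∑ i, N i) → S :=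
  Matrix.vecMul c ((blockDiag A).map (algebraMap R S)) + e

/-- There is a decoder for the code `C`, knowing the transfer matrices `A_i`, that recovers every
codeword from the channel output whenever the error has sum-rank weight at most `t`. -/
def HasDecoder (α : Module.Basis (Fin m) R S) {n N : Fin ℓ → ℕ}
    (C : Set (Fin (∑ i, n i) → S)) (A : (i : Fin ℓ) → Matrix (Fin (n i)) (Fin (N i)) R)
    (t : ℕ) : Prop :=
  ∃ D : (Fin (∑ i, N i) → S) → C,
    ∀ (c : C) (e : Fin (∑ i, N i) → S), wtSR α N e ≤ t → D (channelOutput A c e) = c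

end Metric

end

end SumRank

/-!
Over a commutative ring whose ideals are totally ordered, every matrix has a Smith normal form
(`exists_smith_seq`), and the number of its nonzero diagonal entries equals the least inner size of
a factorization `A = B * C` (`IsSmithDiag.exists_eq_mul`, `IsSmithDiag.card_le_of_eq_mul`). The
lower bound rests on the fact that a matrix with more columns than rows annihilates a unimodular
vector, so a nonzero scalar matrix cannot factor through a smaller size. In this form the rank is
visibly subadditive and does not grow under multiplication, and the free rank is the rank over the
residue field (`frk_eq_rk_map_residue`), so the free rank of a block-diagonal matrix is at most the
sum of the free ranks of its blocks.

A matrix `A` with `m` rows has a right inverse up to a matrix of inner size `m - frk A`, so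
`rk M ≤ rk (M * A) + (m - frk A)`. Summed over the blocks, this says that the channel matrix lowers
the sum-rank weight by at most `n - frk (blockDiag A)` (`wtSR_le_wtSR_vecMul_add`). If two codewords
can lead to the same received word with errors of weight at most `t`, the channel maps their
difference to a vector of weight at most `2 * t`; their distance is then at most `2 * t + ρ`, below
the minimum distance, so they coincide and the received word determines the codeword. The rate of
an MSRD code is read off from `d + k = n + 1`.
-/

open Matrix

namespace SumRank

/-! ### Existence of Smith normal forms -/

section Existence

variable {R : Type*} [CommRing R]

theorem IsChainRing.preValuationRing (hR : IsChainRing R) : PreValuationRing R :=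
  PreValuationRing.iff_ideal_total.2 ⟨hR⟩

theorem exists_dvd_all [PreValuationRing R] {ι : Type*} [Finite ι] [Nonempty ι] (f : ι → R) :
    ∃ i, ∀ j, f i ∣ f j := by
  have : IsTrans R (fun a b => b ∣ a) := ⟨fun _ _ _ h₁ h₂ => h₂.trans h₁⟩
  have hd : Directed (fun a b : R => b ∣ a) f := fun i j =>
    (ValuationRing.dvd_total (f i) (f j)).elim (fun h => ⟨i, dvd_rfl, h⟩) (fun h => ⟨j, h, dvd_rfl⟩)
  exact hd.finite_le id

/-- Equivalence of rectangular matrices over a ring: `A = P * B * Q` with `P` and `Q` invertible. -/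
def MatEquiv {a b : Type*} [Fintype a] [Fintype b] [DecidableEq a] [DecidableEq b]
    (A B : Matrix a b R) : Prop :=
  ∃ (P : Matrix a a R) (Q : Matrix b b R), IsUnit P ∧ IsUnit Q ∧ A = P * B * Q

section MatEquiv

variable {a b a' b' c d : Type*} [Fintype a] [Fintype b] [Fintype a'] [Fintype b'] [Fintype c]
  [Fintype d] [DecidableEq a] [DecidableEq b] [DecidableEq a'] [DecidableEq b'] [DecidableEq c]
  [DecidableEq d]

theorem MatEquiv.trans {A B C : Matrix a b R} (h₁ : MatEquiv A B) (h₂ : MatEquiv B C) :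
    MatEquiv A C := by
  obtain ⟨P, Q, hP, hQ, rfl⟩ := h₁
  obtain ⟨P', Q', hP', hQ', rfl⟩ := h₂
  exact ⟨P * P', Q' * Q, hP.mul hP', hQ'.mul hQ, by simp only [Matrix.mul_assoc]⟩

theorem isUnit_submatrix {P : Matrix a a R} (hP : IsUnit P) (e : c ≃ a) :
    IsUnit (P.submatrix e e) := by
  rw [Matrix.isUnit_iff_isUnit_det] at hP ⊢
  rwa [Matrix.det_submatrix_equiv_self]

theorem MatEquiv.submatrix {A B : Matrix a b R} (h : MatEquiv A B) (e : c ≃ a) (f : d ≃ b) :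
    MatEquiv (A.submatrix e f) (B.submatrix e f) := by
  obtain ⟨P, Q, hP, hQ, rfl⟩ := h
  refine ⟨P.submatrix e e, Q.submatrix f f, isUnit_submatrix hP e, isUnit_submatrix hQ f, ?_⟩
  rw [Matrix.submatrix_mul_equiv, Matrix.submatrix_mul_equiv]

theorem matEquiv_submatrix (A : Matrix a b R) (e : Equiv.Perm a) (f : Equiv.Perm b) :
    MatEquiv A (A.submatrix e f) := by
  refine ⟨(1 : Matrix a a R).submatrix id e, (1 : Matrix b b R).submatrix f id, ?_, ?_, ?_⟩
  · exact IsUnit.of_mul_eq_one ((1 : Matrix a a R).submatrix e id) (by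
      rw [Matrix.submatrix_mul_equiv, Matrix.mul_one, Matrix.submatrix_id_id])
  · refine IsUnit.of_mul_eq_one ((1 : Matrix b b R).submatrix id f) ?_
    have := Matrix.submatrix_mul_equiv (1 : Matrix b b R) 1 f (Equiv.refl b) f
    simpa using this
  · rw [Matrix.submatrix_mul_equiv, Matrix.submatrix_mul_equiv]
    simp

/-- Clearing a row and a column with a pivot that divides all their entries. -/
theorem matEquiv_clear (x : Matrix a a' R) (u : Matrix a' b' R) (v : Matrix b a R)
    (D : Matrix b b' R) :
    MatEquiv (fromBlocks x (x * u) (v * x) D) (fromBlocks x 0 0 (D - v * x * u)) := by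
  refine ⟨fromBlocks 1 0 v 1, fromBlocks 1 u 0 1, ?_, ?_, ?_⟩
  · exact isUnit_fromBlocks_zero₁₂.2 ⟨isUnit_one, isUnit_one⟩
  · exact isUnit_fromBlocks_zero₂₁.2 ⟨isUnit_one, isUnit_one⟩
  · simp [fromBlocks_multiply]

theorem MatEquiv.fromBlocks (x : Matrix a a' R) {D D' : Matrix b b' R} (h : MatEquiv D D') :
    MatEquiv (fromBlocks x 0 0 D) (fromBlocks x 0 0 D') := by
  obtain ⟨P, Q, hP, hQ, rfl⟩ := h
  refine ⟨Matrix.fromBlocks 1 0 0 P, Matrix.fromBlocks 1 0 0 Q, ?_, ?_, ?_⟩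
  · exact isUnit_fromBlocks_zero₁₂.2 ⟨isUnit_one, hP⟩
  · exact isUnit_fromBlocks_zero₂₁.2 ⟨isUnit_one, hQ⟩
  · simp [fromBlocks_multiply]

end MatEquiv

/-- The splitting of the index set `Fin (m + 1)` into its first element and the rest. -/
def finSuccSum (m : ℕ) : Fin (m + 1) ≃ Unit ⊕ Fin m :=
  (finSuccEquiv m).trans ((Equiv.optionEquivSumPUnit (Fin m)).trans (Equiv.sumComm _ _))

@[simp] theorem finSuccSum_zero (m : ℕ) : finSuccSum m 0 = Sum.inl () := by
  simp [finSuccSum]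

@[simp] theorem finSuccSum_succ (m : ℕ) (i : Fin m) : finSuccSum m i.succ = Sum.inr i := by
  simp [finSuccSum]

/-- The divisibility clause on common divisors `x` is what makes the induction work: it shows
that the pivot divides the diagonal obtained from the remaining block. -/
theorem exists_smith_seq [PreValuationRing R] : ∀ (m n : ℕ) (A : Matrix (Fin m) (Fin n) R),
    ∃ f : ℕ → R, MatEquiv A (rectDiag fun i => f i) ∧ (∀ i j, i ≤ j → f i ∣ f j) ∧
      ∀ x, (∀ i j, x ∣ A i j) → ∀ i, x ∣ f i
  | 0, n, A => ⟨fun _ => 0, ⟨1, 1, isUnit_one, isUnit_one, Subsingleton.elim _ _⟩,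
      fun _ _ _ => dvd_rfl, fun _ _ _ => dvd_zero _⟩
  | m + 1, 0, A => ⟨fun _ => 0, ⟨1, 1, isUnit_one, isUnit_one, Subsingleton.elim _ _⟩,
      fun _ _ _ => dvd_rfl, fun _ _ _ => dvd_zero _⟩
  | m + 1, n + 1, A => by
    -- Divisibility is total, so some entry divides all the others.
    obtain ⟨⟨p, q⟩, hpq⟩ := exists_dvd_all fun i : Fin (m + 1) × Fin (n + 1) => A i.1 i.2
    set π := A p q with hπ
    -- Bring the pivot to the upper left corner.
    set A₁ := A.submatrix (Equiv.swap 0 p) (Equiv.swap 0 q) with hA₁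
    have h₁ : MatEquiv A A₁ := matEquiv_submatrix A _ _
    have hdiv : ∀ i j, π ∣ A₁ i j := fun i j => hpq (_, _)
    have h00 : A₁ 0 0 = π := by simp [hA₁, hπ]
    choose g hg using hdiv
    let x : Matrix Unit Unit R := Matrix.of fun _ _ => π
    let u : Matrix Unit (Fin n) R := Matrix.of fun _ j => g 0 j.succ
    let v : Matrix (Fin m) Unit R := Matrix.of fun i _ => g i.succ 0
    let D : Matrix (Fin m) (Fin n) R := Matrix.of fun i j => A₁ i.succ j.succ
    have h₂ : A₁ = (fromBlocks x (x * u) (v * x) D).submatrix (finSuccSum m) (finSuccSum n) := by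
      ext i j
      refine Fin.cases ?_ (fun i => ?_) i <;> refine Fin.cases ?_ (fun j => ?_) j
      · simp [x, h00]
      · simp [x, u, Matrix.mul_apply, hg 0 j.succ]
      · simp [x, v, Matrix.mul_apply, hg i.succ 0, mul_comm]
      · simp [D]
    obtain ⟨f, hf, hmono, hdvd⟩ := exists_smith_seq m n (D - v * x * u)
    have hDdvd : ∀ y, (∀ i j, y ∣ A i j) → ∀ i j, y ∣ (D - v * x * u) i j := by
      intro y hy i j
      have : y ∣ π := hy p q
      simp only [Matrix.sub_apply, Matrix.mul_apply, Finset.univ_unique, Finset.sum_singleton]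
      exact dvd_sub (hy _ _) (((this.mul_left _)).mul_right _)
    refine ⟨fun i => Nat.casesOn i π f, ?_, ?_, ?_⟩
    · have h₃ := ((matEquiv_clear x u v D).trans (hf.fromBlocks x)).submatrix
        (finSuccSum m) (finSuccSum n)
      rw [← h₂] at h₃
      convert h₁.trans h₃ using 1
      ext i j
      refine Fin.cases ?_ (fun i => ?_) i <;> refine Fin.cases ?_ (fun j => ?_) j
      · simp [rectDiag, x]
      · simp [rectDiag]
      · simp [rectDiag]
      · simp [rectDiag]
    · rintro (_ | i) (_ | j) hij
      · exact dvd_rfl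
      · exact hdvd π (hDdvd π fun i j => hpq (i, j)) j
      · omega
      · exact hmono i j (by omega)
    · rintro y hy (_ | i)
      · exact hy p q
      · exact hdvd y (hDdvd y hy) i

theorem isSmithDiag_smithDiag [PreValuationRing R] {m n : ℕ} (A : Matrix (Fin m) (Fin n) R) :
    IsSmithDiag A (smithDiag A) := by
  obtain ⟨f, hf, hmono, -⟩ := exists_smith_seq m n A
  exact Classical.epsilon_spec (p := IsSmithDiag A) ⟨_, hf, fun i j hij => hmono i j hij⟩

end Existence

/-! ### Rank and inner sizes of factorizations -/

section Rank

variable {R : Type*} [CommRing R]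

theorem rectDiag_apply_left {m n : ℕ} (d : Fin (min m n) → R) (k : Fin (min m n)) (j : Fin n) :
    rectDiag d (k.castLE (min_le_left m n)) j = if (k : ℕ) = j then d k else 0 := by
  simp [rectDiag]

/-- A wide matrix annihilates a unimodular vector. -/
theorem exists_unimodular_mulVec_eq_zero [PreValuationRing R] {r s : ℕ} (hrs : r < s)
    (C : Matrix (Fin r) (Fin s) R) : ∃ v w : Fin s → R, C *ᵥ v = 0 ∧ w ⬝ᵥ v = 1 := by
  obtain ⟨⟨P, Q, -, hQ, hC⟩, -⟩ := isSmithDiag_smithDiag C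
  obtain ⟨Q', hQ'⟩ := hQ.exists_right_inv
  -- Column `r` of the Smith normal form of `C` lies beyond its last diagonal entry.
  let k : Fin s := ⟨r, hrs⟩
  refine ⟨Q' *ᵥ Pi.single k 1, Q k, ?_, ?_⟩
  · have : rectDiag (smithDiag C) *ᵥ Pi.single k 1 = 0 := by
      ext i
      have : (i : ℕ) ≠ r := i.2.ne
      simp [rectDiag, k, this]
    rw [hC, Matrix.mulVec_mulVec, Matrix.mul_assoc, hQ', Matrix.mul_one, ← Matrix.mulVec_mulVec,
      this, Matrix.mulVec_zero]
  · have := congrFun (congrFun hQ' k) k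
    rw [Matrix.mul_apply', Matrix.one_apply_eq] at this
    rw [Matrix.mulVec_single_one]
    exact this

/-- A nonzero scalar matrix does not factor through a smaller size. -/
theorem card_le_of_smul_one_eq_mul [PreValuationRing R] {ι κ : Type*} [Fintype ι] [Fintype κ]
    [DecidableEq κ] {δ : R} (hδ : δ ≠ 0) (B : Matrix κ ι R) (C : Matrix ι κ R)
    (h : δ • (1 : Matrix κ κ R) = B * C) : Fintype.card κ ≤ Fintype.card ι := by
  by_contra! hlt
  let e := Fintype.equivFin ι
  let f := Fintype.equivFin κ
  obtain ⟨v, w, hv, hw⟩ := exists_unimodular_mulVec_eq_zero hlt (C.submatrix e.symm f.symm)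
  have h' : δ • (1 : Matrix (Fin (Fintype.card κ)) (Fin (Fintype.card κ)) R) =
      B.submatrix f.symm e.symm * C.submatrix e.symm f.symm := by
    rw [Matrix.submatrix_mul_equiv, ← h]
    ext i j
    simp [Matrix.one_apply]
  apply hδ
  have h0 : δ • v = 0 := by
    rw [← Matrix.one_mulVec v, ← Matrix.smul_mulVec, h', ← Matrix.mulVec_mulVec, hv,
      Matrix.mulVec_zero]
  calc δ = w ⬝ᵥ (δ • v) := by rw [dotProduct_smul, hw, smul_eq_mul, mul_one]
    _ = 0 := by rw [h0, dotProduct_zero]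

variable {m n : ℕ} {A : Matrix (Fin m) (Fin n) R} {d : Fin (min m n) → R}

/-- The nonzero diagonal entries of a Smith normal form are at most as many as the inner size of
any factorization: by the divisibility chain, the corresponding diagonal block can be multiplied up
to a scalar matrix given by its last entry. -/
theorem IsSmithDiag.card_le_of_eq_mul [PreValuationRing R] (hd : IsSmithDiag A d) {ι : Type*}
    [Fintype ι] (B : Matrix (Fin m) ι R) (C : Matrix ι (Fin n) R) (h : A = B * C) :
    Nat.card {i // d i ≠ 0} ≤ Fintype.card ι := by
  classical
  obtain ⟨⟨P, Q, hP, hQ, hA⟩, hdvd⟩ := hd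
  rw [Nat.card_eq_fintype_card]
  cases isEmpty_or_nonempty {i // d i ≠ 0} with
  | inl _ => simp
  | inr _ =>
    obtain ⟨k, hk⟩ := Finite.exists_max (id : {i // d i ≠ 0} → _)
    have hdk : ∀ i : {i // d i ≠ 0}, d i ∣ d k := fun i => hdvd _ _ (hk i)
    choose e he using hdk
    obtain ⟨P', hP'⟩ := hP.exists_left_inv
    obtain ⟨Q', hQ'⟩ := hQ.exists_right_inv
    have hD : rectDiag d = P' * B * (C * Q') := by
      calc rectDiag d = (P' * P) * rectDiag d * (Q * Q') := by rw [hP', hQ']; simp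
        _ = P' * (P * rectDiag d * Q) * Q' := by simp only [Matrix.mul_assoc]
        _ = _ := by rw [← hA, h]; simp only [Matrix.mul_assoc]
    let l : {i // d i ≠ 0} → Fin m := fun i => i.1.castLE (min_le_left m n)
    let r : {i // d i ≠ 0} → Fin n := fun i => i.1.castLE (min_le_right m n)
    refine card_le_of_smul_one_eq_mul k.2
      (Matrix.of fun i t => e i * (P' * B) (l i) t) ((C * Q').submatrix id r) ?_
    ext i j
    have h1 := congrFun (congrFun hD (l i)) (r j)
    rw [rectDiag_apply_left, Matrix.mul_apply] at h1
    simp only [Matrix.mul_apply, Matrix.of_apply, Matrix.submatrix_apply, id, mul_assoc]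
    simp only [Matrix.mul_apply] at h1
    rw [← Finset.mul_sum, ← h1]
    by_cases hij : i = j
    · subst hij
      simp [r, he i, mul_comm]
    · have : ¬ ((i : Fin (min m n)) : ℕ) = ((j : Fin (min m n)) : ℕ) := fun h =>
        hij (Subtype.ext (Fin.ext h))
      simp [r, hij, this]

theorem IsSmithDiag.exists_eq_mul (hd : IsSmithDiag A d) :
    ∃ (B : Matrix (Fin m) (Fin (Nat.card {i // d i ≠ 0})) R)
      (C : Matrix (Fin (Nat.card {i // d i ≠ 0})) (Fin n) R), A = B * C := by
  classical
  obtain ⟨⟨P, Q, -, -, hA⟩, -⟩ := hd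
  let e : Fin (Nat.card {i // d i ≠ 0}) ≃ {i // d i ≠ 0} := (Finite.equivFin _).symm
  let B : Matrix (Fin m) {i // d i ≠ 0} R := Matrix.of fun i t => if (i : ℕ) = t then d t else 0
  let C : Matrix {i // d i ≠ 0} (Fin n) R := Matrix.of fun t j => if (t : ℕ) = j then 1 else 0
  refine ⟨P * B.submatrix id e, C.submatrix e id * Q, ?_⟩
  have hBC : rectDiag d = B * C := by
    ext i j
    simp only [rectDiag, Matrix.mul_apply, Matrix.of_apply, B, C, mul_ite, mul_one, mul_zero]
    split_ifs with h
    · let k : Fin (min m n) := ⟨i, lt_min i.isLt (h ▸ j.isLt)⟩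
      change d k = _
      by_cases h0 : d k = 0
      · rw [h0, Finset.sum_eq_zero]
        intro t _
        have : ¬ (i : ℕ) = t := fun h2 => t.2 (by rwa [← (Fin.ext h2 : k = t)])
        simp [this]
      · rw [Finset.sum_eq_single (⟨k, h0⟩ : {i // d i ≠ 0})]
        · simp [h, k]
        · intro t _ ht
          have : ¬ (i : ℕ) = t := fun h2 => ht (Subtype.ext (Fin.ext h2.symm))
          simp [this]
        · simp
    · rw [Finset.sum_eq_zero]
      intro t _
      split_ifs with h1 h2
      · omega
      · rfl
      · rfl
  have hBC' : B.submatrix id e * C.submatrix e id = B * C := by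
    rw [Matrix.submatrix_mul_equiv, Matrix.submatrix_id_id]
  rw [hA, hBC, ← hBC']
  simp only [Matrix.mul_assoc]

theorem rk_le_card_of_eq_mul [PreValuationRing R] {ι : Type*} [Fintype ι]
    (B : Matrix (Fin m) ι R) (C : Matrix ι (Fin n) R) (h : A = B * C) :
    rk A ≤ Fintype.card ι :=
  (isSmithDiag_smithDiag A).card_le_of_eq_mul B C h

theorem exists_eq_mul_rk [PreValuationRing R] (A : Matrix (Fin m) (Fin n) R) :
    ∃ (B : Matrix (Fin m) (Fin (rk A)) R) (C : Matrix (Fin (rk A)) (Fin n) R), A = B * C :=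
  (isSmithDiag_smithDiag A).exists_eq_mul

theorem rk_eq_card_of_isSmithDiag [PreValuationRing R] (hd : IsSmithDiag A d) :
    rk A = Nat.card {i // d i ≠ 0} := by
  apply le_antisymm
  · obtain ⟨B, C, h⟩ := hd.exists_eq_mul
    simpa using rk_le_card_of_eq_mul B C h
  · obtain ⟨B, C, h⟩ := exists_eq_mul_rk A
    simpa using hd.card_le_of_eq_mul B C h

theorem rk_add_le [PreValuationRing R] (A B : Matrix (Fin m) (Fin n) R) :
    rk (A + B) ≤ rk A + rk B := by
  obtain ⟨A₁, A₂, hA⟩ := exists_eq_mul_rk A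
  obtain ⟨B₁, B₂, hB⟩ := exists_eq_mul_rk B
  have h : A + B = A₁.fromCols B₁ * A₂.fromRows B₂ := by
    rw [Matrix.fromCols_mul_fromRows, ← hA, ← hB]
  simpa using rk_le_card_of_eq_mul _ _ h

theorem rk_mul_le_left [PreValuationRing R] {p : ℕ} (A : Matrix (Fin m) (Fin n) R)
    (B : Matrix (Fin n) (Fin p) R) : rk (A * B) ≤ rk A := by
  obtain ⟨A₁, A₂, hA⟩ := exists_eq_mul_rk A
  have h : A * B = A₁ * (A₂ * B) := by rw [← Matrix.mul_assoc, ← hA]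
  simpa using rk_le_card_of_eq_mul _ _ h

theorem rk_neg_le [PreValuationRing R] (A : Matrix (Fin m) (Fin n) R) : rk (-A) ≤ rk A := by
  have h := rk_mul_le_left A (-1 : Matrix (Fin n) (Fin n) R)
  rwa [Matrix.mul_neg, Matrix.mul_one] at h

theorem rk_sub_le [PreValuationRing R] (A B : Matrix (Fin m) (Fin n) R) :
    rk (A - B) ≤ rk A + rk B := by
  rw [sub_eq_add_neg]
  exact (rk_add_le A (-B)).trans (Nat.add_le_add_left (rk_neg_le B) _)

end Rank

/-! ### The free rank -/

section FreeRank

variable {R : Type*} [CommRing R] {m n : ℕ}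

theorem isUnit_map {k : Type*} [CommRing k] (f : R →+* k) {a : Type*} [Fintype a] [DecidableEq a]
    {P : Matrix a a R} (hP : IsUnit P) : IsUnit (P.map f) :=
  hP.map f.mapMatrix

/-- The free rank is the rank over the residue field: reducing a Smith normal form modulo the
maximal ideal keeps exactly the unit entries. -/
theorem frk_eq_rk_map_residue [PreValuationRing R] [IsLocalRing R]
    (A : Matrix (Fin m) (Fin n) R) : frk A = rk (A.map (IsLocalRing.residue R)) := by
  obtain ⟨⟨P, Q, hP, hQ, hA⟩, hdvd⟩ := isSmithDiag_smithDiag A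
  have hd : IsSmithDiag (A.map (IsLocalRing.residue R))
      fun i => IsLocalRing.residue R (smithDiag A i) := by
    refine ⟨⟨P.map (IsLocalRing.residue R), Q.map (IsLocalRing.residue R), isUnit_map _ hP,
      isUnit_map _ hQ, ?_⟩, fun i j hij => map_dvd _ (hdvd i j hij)⟩
    conv_lhs => rw [hA, Matrix.map_mul, Matrix.map_mul]
    congr 2
    ext i j
    simp only [rectDiag, Matrix.map_apply, Matrix.of_apply]
    split_ifs <;> simp
  rw [rk_eq_card_of_isSmithDiag hd, frk]
  simp only [IsLocalRing.residue_ne_zero_iff_isUnit]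

theorem rk_blockDiag_le [PreValuationRing R] {ℓ : ℕ} {n N : Fin ℓ → ℕ}
    (A : (i : Fin ℓ) → Matrix (Fin (n i)) (Fin (N i)) R) :
    rk (blockDiag A) ≤ ∑ i, rk (A i) := by
  choose B C h using fun i => exists_eq_mul_rk (A i)
  have := rk_le_card_of_eq_mul (A := blockDiag A)
    ((Matrix.blockDiagonal' B).submatrix finSigmaFinEquiv.symm id)
    ((Matrix.blockDiagonal' C).submatrix id finSigmaFinEquiv.symm) (by
      have h' : A = fun i => B i * C i := funext h
      conv_lhs => rw [h']
      rw [blockDiag, Matrix.reindex_apply, Matrix.blockDiagonal'_mul]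
      rfl)
  simpa using this

theorem frk_blockDiag_le [PreValuationRing R] [IsLocalRing R] {ℓ : ℕ} {n N : Fin ℓ → ℕ}
    (A : (i : Fin ℓ) → Matrix (Fin (n i)) (Fin (N i)) R) :
    frk (blockDiag A) ≤ ∑ i, frk (A i) := by
  simp only [frk_eq_rk_map_residue]
  convert rk_blockDiag_le fun i => (A i).map (IsLocalRing.residue R) using 2
  rw [blockDiag, blockDiag, Matrix.reindex_apply, Matrix.reindex_apply, ← Matrix.submatrix_map,
    Matrix.blockDiagonal'_map _ _ (map_zero _)]

theorem frk_le_left (A : Matrix (Fin m) (Fin n) R) : frk A ≤ m :=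
  (Finite.card_subtype_le _).trans (by simp)

/-- A right inverse up to a matrix of small rank: `X` inverts the unit diagonal entries of the
Smith normal form, and `B * C` accounts for the rows of the remaining ones. -/
theorem exists_one_eq_mul_add_mul [PreValuationRing R] (A : Matrix (Fin m) (Fin n) R) :
    ∃ (X : Matrix (Fin n) (Fin m) R) (B : Matrix (Fin m) (Fin (m - frk A)) R)
      (C : Matrix (Fin (m - frk A)) (Fin m) R), 1 = A * X + B * C := by
  classical
  obtain ⟨⟨P, Q, hP, hQ, hA⟩, -⟩ := isSmithDiag_smithDiag A
  set d := smithDiag A with hd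
  obtain ⟨P', hP'⟩ := hP.exists_right_inv
  obtain ⟨Q', hQ'⟩ := hQ.exists_right_inv
  let l : {i // IsUnit (d i)} ↪ Fin m :=
    ⟨fun i => i.1.castLE (min_le_left m n), fun i j h => Subtype.ext (Fin.castLE_injective _ h)⟩
  let J := {i : Fin m // ¬ i ∈ Set.range l}
  have hJ : Fintype.card J = m - frk A := by
    rw [Fintype.card_subtype_compl, Fintype.card_fin, frk, Nat.card_eq_fintype_card]
    congr 1
    exact (Fintype.card_congr (Equiv.ofInjective l l.injective)).symm
  let e : Fin (m - frk A) ≃ J := (Fintype.equivFinOfCardEq hJ).symm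
  let B : Matrix (Fin m) J R := Matrix.of fun i t => if i = t then 1 else 0
  let C : Matrix J (Fin m) R := Matrix.of fun t i => if t = i then 1 else 0
  -- `Ring.inverse` is zero on non-units, so `rectDiag d * E` has a one exactly at the positions of
  -- the unit entries, and `B * C` has a one at the remaining positions of the diagonal.
  let E : Matrix (Fin n) (Fin m) R :=
    Matrix.of fun j i => if h : (i : ℕ) = j then
      Ring.inverse (d ⟨i, lt_min i.isLt (h ▸ j.isLt)⟩) else 0
  have key : (1 : Matrix (Fin m) (Fin m) R) = rectDiag d * E + B * C := by
    ext i j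
    rw [Matrix.add_apply, Matrix.mul_apply, Matrix.mul_apply]
    have hE : ∀ s k, E k (l s) = if ((s : Fin (min m n)) : ℕ) = k then Ring.inverse (d s) else 0 :=
      fun _ _ => rfl
    by_cases hj : j ∈ Set.range l
    · obtain ⟨s, rfl⟩ := hj
      have h₁ : ∑ t, B i t * C t (l s) = 0 := Finset.sum_eq_zero fun t _ => by
        have : (t : Fin m) ≠ l s := fun h => t.2 ⟨s, h.symm⟩
        simp [C, this]
      rw [h₁, add_zero, Finset.sum_eq_single (s.1.castLE (min_le_right m n))]
      · by_cases hi : i = l s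
        · have hD : rectDiag d (l s) (s.1.castLE (min_le_right m n)) = d s :=
            (rectDiag_apply_left d s.1 _).trans (if_pos rfl)
          rw [hi, hD, hE, if_pos (by rfl), Ring.mul_inverse_cancel _ s.2]
          exact Matrix.one_apply_eq _
        · have : ¬ (i : ℕ) = s := fun h => hi (Fin.ext h)
          simp [rectDiag, hi, this]
      · intro k _ hk
        have : ¬ (s : ℕ) = k := fun h => hk (Fin.ext h.symm)
        rw [hE, if_neg this, mul_zero]
      · simp
    · have h₁ : ∑ k, rectDiag d i k * E k j = 0 := Finset.sum_eq_zero fun k _ => by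
        by_cases hk : (j : ℕ) = k
        · have : ¬ IsUnit (d ⟨j, lt_min j.isLt (hk ▸ k.isLt)⟩) := fun h => hj ⟨⟨_, h⟩, rfl⟩
          simp only [E, Matrix.of_apply, dif_pos hk, Ring.inverse_non_unit _ this, mul_zero]
        · simp [E, hk]
      rw [h₁, zero_add, Finset.sum_eq_single (⟨j, hj⟩ : J)]
      · simp [B, C, Matrix.one_apply]
      · intro t _ ht
        have : (t : Fin m) ≠ j := fun h => ht (Subtype.ext h)
        simp [C, this]
      · simp
  refine ⟨Q' * E * P', P * B.submatrix id e, C.submatrix e id * P', ?_⟩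
  have hBC : B.submatrix id e * C.submatrix e id = B * C := by
    rw [Matrix.submatrix_mul_equiv, Matrix.submatrix_id_id]
  calc (1 : Matrix (Fin m) (Fin m) R) = P * 1 * P' := by rw [Matrix.mul_one, hP']
    _ = P * rectDiag d * (Q * Q') * E * P' + P * (B.submatrix id e * C.submatrix e id) * P' := by
      rw [key, hQ', hBC]
      simp only [Matrix.mul_add, Matrix.add_mul, Matrix.mul_assoc, Matrix.one_mul]
    _ = (P * rectDiag d * Q) * (Q' * E * P') + P * B.submatrix id e * (C.submatrix e id * P') := by
      simp only [Matrix.mul_assoc]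
    _ = _ := by rw [← hA]

theorem rk_le_rk_mul_add [PreValuationRing R] {p : ℕ} (M : Matrix (Fin p) (Fin m) R)
    (A : Matrix (Fin m) (Fin n) R) : rk M ≤ rk (M * A) + (m - frk A) := by
  obtain ⟨X, B, C, h⟩ := exists_one_eq_mul_add_mul A
  have hM : M = M * A * X + M * B * C := by
    calc M = M * 1 := (Matrix.mul_one M).symm
      _ = _ := by rw [h]; simp only [Matrix.mul_add, Matrix.mul_assoc]
  calc rk M = rk (M * A * X + M * B * C) := by rw [← hM]
    _ ≤ rk (M * A * X) + rk (M * B * C) := rk_add_le _ _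
    _ ≤ rk (M * A) + (m - frk A) := by
      refine Nat.add_le_add (rk_mul_le_left _ _) ?_
      simpa using rk_le_card_of_eq_mul (M * B) C rfl

end FreeRank

/-! ### The sum-rank weight and the channel -/

section Channel

variable {R S : Type*} [CommRing R] [CommRing S] [Algebra R S] {m ℓ : ℕ}

theorem matrixRep_sub (α : Module.Basis (Fin m) R S) {s : ℕ} (c d : Fin s → S) :
    matrixRep α (c - d) = matrixRep α c - matrixRep α d := by
  ext i j
  simp [matrixRep]

theorem matrixRep_vecMul (α : Module.Basis (Fin m) R S) {s r : ℕ} (c : Fin s → S)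
    (A : Matrix (Fin s) (Fin r) R) :
    matrixRep α (c ᵥ* A.map (algebraMap R S)) = matrixRep α c * A := by
  ext i j
  simp [matrixRep, Matrix.mul_apply, Matrix.vecMul, dotProduct, mul_comm _ (algebraMap R S _),
    ← Algebra.smul_def, mul_comm (A _ _)]

theorem block_vecMul_blockDiag {n N : Fin ℓ → ℕ}
    (A : (i : Fin ℓ) → Matrix (Fin (n i)) (Fin (N i)) R) (c : Fin (∑ i, n i) → S) (i : Fin ℓ) :
    block N (c ᵥ* (blockDiag A).map (algebraMap R S)) i =
      block n c i ᵥ* (A i).map (algebraMap R S) := by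
  ext j
  simp only [block, Matrix.vecMul, dotProduct, ← finSigmaFinEquiv.sum_comp, Fintype.sum_sigma,
    Matrix.map_apply, blockDiag, Matrix.reindex_apply, Matrix.submatrix_apply,
    Equiv.symm_apply_apply]
  rw [Finset.sum_eq_single i]
  · simp [Matrix.blockDiagonal'_apply_eq]
  · intro k _ hk
    simp [Matrix.blockDiagonal'_apply_ne _ _ _ hk]
  · simp

theorem wtSR_sub_le [PreValuationRing R] (α : Module.Basis (Fin m) R S) (n : Fin ℓ → ℕ)
    (c d : Fin (∑ i, n i) → S) : wtSR α n (c - d) ≤ wtSR α n c + wtSR α n d := by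
  rw [wtSR, wtSR, wtSR, ← Finset.sum_add_distrib]
  refine Finset.sum_le_sum fun i _ => ?_
  have : block n (c - d) i = block n c i - block n d i := rfl
  rw [this, matrixRep_sub]
  exact rk_sub_le _ _

/-- The channel matrix lowers the sum-rank weight by at most its free-rank deficiency. -/
theorem wtSR_le_wtSR_vecMul_add [PreValuationRing R] [IsLocalRing R]
    (α : Module.Basis (Fin m) R S) {n N : Fin ℓ → ℕ}
    (A : (i : Fin ℓ) → Matrix (Fin (n i)) (Fin (N i)) R) (c : Fin (∑ i, n i) → S) :
    wtSR α n c + frk (blockDiag A) ≤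
      wtSR α N (c ᵥ* (blockDiag A).map (algebraMap R S)) + ∑ i, n i := by
  refine (Nat.add_le_add_left (frk_blockDiag_le A) _).trans ?_
  rw [wtSR, wtSR, ← Finset.sum_add_distrib, ← Finset.sum_add_distrib]
  refine Finset.sum_le_sum fun i _ => ?_
  rw [block_vecMul_blockDiag, matrixRep_vecMul]
  have h₁ := rk_le_rk_mul_add (matrixRep α (block n c i)) (A i)
  have h₂ := frk_le_left (A i)
  omega

theorem minDistSR_le (α : Module.Basis (Fin m) R S) (n : Fin ℓ → ℕ)
    {C : Set (Fin (∑ i, n i) → S)} {c d : Fin (∑ i, n i) → S} (hc : c ∈ C) (hd : d ∈ C)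
    (hcd : c ≠ d) : minDistSR α n C ≤ distSR α n c d :=
  iInf_le_of_le c <| iInf_le_of_le hc <| iInf_le_of_le d <| iInf_le_of_le hd <|
    iInf_le_of_le hcd le_rfl

/-- Two codewords that the channel can confuse are at distance at most `2 * t` plus the free-rank
deficiency, so when this is below the minimum distance the received word determines the
codeword. -/
theorem hasDecoder_of_le_minDistSR [PreValuationRing R] [IsLocalRing R]
    (α : Module.Basis (Fin m) R S) {n N : Fin ℓ → ℕ} {C : Set (Fin (∑ i, n i) → S)}
    (hC : C.Nonempty) (A : (i : Fin ℓ) → Matrix (Fin (n i)) (Fin (N i)) R) (t ρ : ℕ)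
    (hρ : ∑ i, n i ≤ frk (blockDiag A) + ρ)
    (hd : ((2 * t + ρ + 1 : ℕ) : ℕ∞) ≤ minDistSR α n C) : HasDecoder α C A t := by
  classical
  have key : ∀ (c c' : C) (e e' : Fin (∑ i, N i) → S), wtSR α N e ≤ t → wtSR α N e' ≤ t →
      channelOutput A (c : Fin (∑ i, n i) → S) e = channelOutput A c' e' → c = c' := by
    intro c c' e e' he he' h
    by_contra hne
    have h₁ := hd.trans (minDistSR_le α n c.2 c'.2 fun h => hne (Subtype.ext h))
    rw [Nat.cast_le, distSR] at h₁
    have h₂ := wtSR_le_wtSR_vecMul_add α A (c.1 - c'.1)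
    have h₃ : (c.1 - c'.1) ᵥ* (blockDiag A).map (algebraMap R S) = e' - e := by
      rw [Matrix.sub_vecMul, sub_eq_sub_iff_add_eq_add, add_comm e']
      simpa [channelOutput, add_comm] using h
    rw [h₃] at h₂
    have h₄ := wtSR_sub_le α N e' e
    omega
  refine ⟨fun y => if h : ∃ (c : C) (e : Fin (∑ i, N i) → S), wtSR α N e ≤ t ∧
    channelOutput A (c : Fin (∑ i, n i) → S) e = y then h.choose else ⟨hC.some, hC.some_mem⟩, ?_⟩
  intro c e he
  have hex : ∃ (c' : C) (e' : Fin (∑ i, N i) → S), wtSR α N e' ≤ t ∧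
    channelOutput A (c' : Fin (∑ i, n i) → S) e' = channelOutput A c e := ⟨c, e, he, rfl⟩
  simp only [dif_pos hex]
  obtain ⟨e', he', h⟩ := hex.choose_spec
  exact key _ _ _ _ he' he h

theorem IsMSRD.rate_eq {α : Module.Basis (Fin m) R S} {n : Fin ℓ → ℕ}
    {C : Set (Fin (∑ i, n i) → S)} (hC : IsMSRD α n C) {t ρ : ℕ}
    (hd : minDistSR α n C = ((2 * t + ρ + 1 : ℕ) : ℕ∞)) :
    rate C = (((∑ i, n i : ℕ) : ℝ) - 2 * (t : ℝ) - (ρ : ℝ)) / ((∑ i, n i : ℕ) : ℝ) := by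
  obtain ⟨k, -, hk, hdk⟩ := hC
  rw [hd] at hdk
  have h : 2 * t + ρ + 1 + k = (∑ i, n i) + 1 := by exact_mod_cast hdk
  have h' : (k : ℝ) = ((∑ i, n i : ℕ) : ℝ) - 2 * t - ρ := by
    have : ((2 * t + ρ + 1 + k : ℕ) : ℝ) = (((∑ i, n i) + 1 : ℕ) : ℝ) := by rw [h]
    rw [Nat.cast_add, Nat.cast_add, Nat.cast_add, Nat.cast_mul, Nat.cast_add _ 1] at this
    push_cast at this ⊢
    linarith
  rw [rate, hk, h']

end Channel

end SumRank

theorem mainTheorem9 {R : Type*} [CommRing R] [Finite R] [IsLocalRing R]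
    (hR : SumRank.IsChainRing R)
    (h : R[X]) (hmonic : h.Monic) (hirr : Irreducible (h.map (IsLocalRing.residue R)))
    (α : Module.Basis (Fin h.natDegree) R (AdjoinRoot h))
    {ℓ : ℕ} (n : Fin ℓ → ℕ)
    (C : Set (Fin (∑ i, n i) → AdjoinRoot h)) (hC : C.Nonempty) :
    (∀ (N : Fin ℓ → ℕ) (A : (i : Fin ℓ) → Matrix (Fin (n i)) (Fin (N i)) R) (t ρ : ℕ),
      (ρ : ℤ) = ((∑ i, n i : ℕ) : ℤ) - (SumRank.frk (SumRank.blockDiag A) : ℤ) →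
      ((2 * t + ρ + 1 : ℕ) : ℕ∞) ≤ SumRank.minDistSR α n C →
      SumRank.HasDecoder α C A t) ∧
    (SumRank.IsMSRD α n C →
      ∀ t ρ : ℕ, ((2 * t + ρ + 1 : ℕ) : ℕ∞) ≤ SumRank.minDistSR α n C →
        (∀ (N : Fin ℓ → ℕ) (A : (i : Fin ℓ) → Matrix (Fin (n i)) (Fin (N i)) R),
          ((∑ i, n i : ℕ) : ℤ) - (ρ : ℤ) ≤ (SumRank.frk (SumRank.blockDiag A) : ℤ) →
          SumRank.HasDecoder α C A t) ∧
        (SumRank.minDistSR α n C = ((2 * t + ρ + 1 : ℕ) : ℕ∞) →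
          SumRank.rate C =
            (((∑ i, n i : ℕ) : ℝ) - 2 * (t : ℝ) - (ρ : ℝ)) / ((∑ i, n i : ℕ) : ℝ))) := by
  have := hR.preValuationRing
  refine ⟨fun N A t ρ hρ hd => SumRank.hasDecoder_of_le_minDistSR α hC A t ρ (by omega) hd,
    fun hM t ρ hd => ⟨fun N A hρ => SumRank.hasDecoder_of_le_minDistSR α hC A t ρ (by omega) hd,
      fun h => hM.rate_eq h⟩⟩
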